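/- **Resource terms.** Simple types are generated by $A,B ::= o \mid A\to B$. Resource terms and bags are given by $s ::= x \mid \lambda x.s \mid s\,\bar t$ and $\bar t ::= [s_1,\dots,s_n]$ (finite multisets); variables carry a type, and terms are taken up to renaming of bound variables. The $\eta$-long typing rules are: $\Gamma\vdash \lambda x.s : A\to B$ if $\Gamma,x:A\vdash s:B$; $\Gamma\vdash s\,\bar t: B$ if $\Gamma\vdash s:A\to B$ and $\Gamma\vdash\bar t:A$; $\Gamma\vdash x\,\bar t_1\cdots\bar t_n:o$ if $(x:A_1\to\cdots\to A_n\to o)\in\Gamma$ and $\Gamma\vdash \bar t_i:A_i$ for all $i$; and $\Gamma\vdash[s_1,\dots,s_n]:A$ if $\Gamma\vdash s_i:A$ for all $i$. Resource substitution $s\langle\bar t/x\rangle$ is the finite formal sum (with multiplicities) of all terms obtained by replacing each free occurrence of $x$ in $s$ by exactly one element of $\bar t$, using each element exactly once ($0$ if the numbers do not match). Reduction $\leadsto$ of terms and bags to finite formal sums is the closure of $(\lambda x.s)\,\bar t\leadsto s\langle\bar t/x\rangle$ under all term and bag contexts (extended linearly to sums), and for sums $S=s+T$, $S'=S_1+T$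 with $s\leadsto S_1$ one puts $S\leadsto S'$. **Resource categories.** A closed resource category $\mathcal C$ is a symmetric monoidal category whose hom-sets are commutative monoids, with composition and tensor additive (and preserving $0$) in each argument, where every object $A$ carries a commutative and cocommutative bialgebra structure $(\delta_A,\epsilon_A,\mu_A,\eta_A)$ compatible with $\otimes$ and $I$, and an idempotent $\mathrm{id}^\bullet_A:A\to A$ (pointed identity) with $\delta_A\circ\mathrm{id}^\bullet_A=\mathrm{id}^\bullet_A\otimes\eta_A+\eta_A\otimes\mathrm{id}^\bullet_A$, $\mathrm{id}^\bullet_A\circ\mu_A=\mathrm{id}^\bullet_A\otimes\epsilon_A+\epsilon_A\otimes\mathrm{id}^\bullet_A$ (up to unitors), $\epsilon_A\circ\mathrm{id}^\bullet_A=0$, $\mathrm{id}^\bullet_A\circ\eta_A=0$; and where each $-\otimes A$ has a right adjoint $A\Rightarrow-$, with currying $\Lambda$ and evaluation $\mathrm{ev}$. A morphism $f:X\to Y$ is pointed if $\mathrm{id}^\bullet_Y\circ f=f$. Write $\langle f,g\rangle=(f\otimes g)\circ\delta$, $f*g=\mu\circ\langle f,g\rangle$, and $\Pi[f_1,\dots,f_n]=f_1*\cdots*f_n$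 (equal to $\eta\circ\epsilon$ for $n=0$). **Interpretation.** Fix an object $o$ of $\mathcal C$. Put $[\![o]\!]=o$, $[\![A\to B]\!]=[\![A]\!]\Rightarrow[\![B]\!]$, interpret contexts and tuples of types by tensor products, and terms $\Gamma\vdash s:A$ by morphisms $[\![s]\!]:[\![\Gamma]\!]\to[\![A]\!]$: up to the evident structural isomorphisms, $[\![\lambda x.s]\!]=\Lambda([\![s]\!])$, $[\![s\,\bar t]\!]=\mathrm{ev}\circ\langle[\![s]\!],\Pi[\![\bar t]\!]\rangle$, $[\![x\,\bar t_1\cdots\bar t_n]\!]=\mathrm{ev}\circ\langle\mathrm{id}^\bullet\circ\zeta\circ\pi_x,\langle\Pi[\![\bar t_1]\!],\dots,\Pi[\![\bar t_n]\!]\rangle\rangle$, where $[\![[s_1,\dots,s_n]]\!]=[[\![s_1]\!],\dots,[\![s_n]\!]]$, $\pi_x$ is the projection on $x$ and $\zeta:[\![A_1\to\cdots\to A_n\to o]\!]\cong([\![A_1]\!]\otimes\cdots\otimes[\![A_n]\!])\Rightarrow o$ is the currying isomorphism. Formal sums of terms are interpreted by sums of morphisms. **Theorem (invariance).** Let $\mathcal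 C$ be a closed resource category whose pointed identities are compatible with currying, i.e. $\mathrm{id}^\bullet_{A\Rightarrow B}\circ\Lambda(f)=\Lambda(\mathrm{id}^\bullet_B\circ f)$ for all $f:X\otimes A\to B$, and let $o$ be an object of $\mathcal C$. Then every term $\Gamma\vdash s:A$ is interpreted by a pointed morphism, and for all finite formal sums $S,S'$ of terms of type $A$ in context $\Gamma$, if $S\leadsto S'$ then $[\![S]\!]=[\![S']\!]$. -/

import Mathlib

open CategoryTheory MonoidalCategory

namespace ResourceCalculus

/-! ### Syntax: simply typed, eta-long resource terms

Variables are de Bruijn indices, so that terms are identified up to renaming of bound variables; a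
context is the list of the types of its variables, most recent first. Terms are intrinsically
typed: `Exp k Γ` is the family of typing derivations of expressions of kind `k` in context `Γ`. -/

/-- Simple types over one base type. -/
inductive Ty : Type
  | base : Ty
  | arr : Ty → Ty → Ty

/-- The type `A₁ → ⋯ → Aₙ → B`. -/
def arrs : List Ty → Ty → Ty
  | [], B => B
  | A :: As, B => .arr A (arrs As B)

/-- The three kinds of judgements: terms of type `A`, bags of terms of type `A`, and sequences
(tuples of bags) of types `A₁, …, Aₙ`. -/
inductive Kind : Type
  | tm : Ty → Kind
  | bg : Ty → Kind
  | sq : List Ty → Kind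

/-- `Var Γ A`: the variables of type `A` in the context `Γ`. -/
inductive Var : List Ty → Ty → Type
  | zero {Γ : List Ty} {A : Ty} : Var (A :: Γ) A
  | succ {Γ : List Ty} {A B : Ty} : Var Γ A → Var (B :: Γ) A

/-- Typed expressions, with bags given by an enumeration of their elements. The order of this
enumeration is forgotten below, see `Eqv` and `Tm`. Variables are fully applied. -/
inductive Exp : Kind → List Ty → Type
  | lam {Γ : List Ty} {A B : Ty} : Exp (.tm B) (A :: Γ) → Exp (.tm (.arr A B)) Γ
  | app {Γ : List Ty} {A B : Ty} : Exp (.tm (.arr A B)) Γ → Exp (.bg A) Γ → Exp (.tm B) Γ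
  | var {Γ : List Ty} {As : List Ty} :
      Var Γ (arrs As .base) → Exp (.sq As) Γ → Exp (.tm .base) Γ
  | bnil {Γ : List Ty} {A : Ty} : Exp (.bg A) Γ
  | bcons {Γ : List Ty} {A : Ty} : Exp (.tm A) Γ → Exp (.bg A) Γ → Exp (.bg A) Γ
  | snil {Γ : List Ty} : Exp (.sq []) Γ
  | scons {Γ : List Ty} {A : Ty} {As : List Ty} :
      Exp (.bg A) Γ → Exp (.sq As) Γ → Exp (.sq (A :: As)) Γ

namespace Exp

/-- Equality of expressions up to the order of the elements in each bag: the congruence generated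
by exchanging two consecutive elements of a bag. -/
inductive Eqv : {k : Kind} → {Γ : List Ty} → Exp k Γ → Exp k Γ → Prop
  | refl {k : Kind} {Γ : List Ty} (e : Exp k Γ) : Eqv e e
  | symm {k : Kind} {Γ : List Ty} {e e' : Exp k Γ} : Eqv e e' → Eqv e' e
  | trans {k : Kind} {Γ : List Ty} {e e' e'' : Exp k Γ} : Eqv e e' → Eqv e' e'' → Eqv e e''
  | swap {Γ : List Ty} {A : Ty} (s t : Exp (.tm A) Γ) (b : Exp (.bg A) Γ) :
      Eqv (bcons s (bcons t b)) (bcons t (bcons s b))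
  | lam {Γ : List Ty} {A B : Ty} {s s' : Exp (.tm B) (A :: Γ)} :
      Eqv s s' → Eqv (lam s) (lam s')
  | app {Γ : List Ty} {A B : Ty} {s s' : Exp (.tm (.arr A B)) Γ} {b b' : Exp (.bg A) Γ} :
      Eqv s s' → Eqv b b' → Eqv (app s b) (app s' b')
  | var {Γ : List Ty} {As : List Ty} (x : Var Γ (arrs As .base)) {c c' : Exp (.sq As) Γ} :
      Eqv c c' → Eqv (var x c) (var x c')
  | bcons {Γ : List Ty} {A : Ty} {s s' : Exp (.tm A) Γ} {b b' : Exp (.bg A) Γ} :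
      Eqv s s' → Eqv b b' → Eqv (bcons s b) (bcons s' b')
  | scons {Γ : List Ty} {A : Ty} {As : List Ty} {b b' : Exp (.bg A) Γ} {c c' : Exp (.sq As) Γ} :
      Eqv b b' → Eqv c c' → Eqv (scons b c) (scons b' c')

/-- Extension of a renaming of variables under a binder. -/
def liftRen {Γ Δ : List Ty} {B : Ty} (r : ∀ A, Var Γ A → Var Δ A) :
    ∀ A, Var (B :: Γ) A → Var (B :: Δ) A
  | _, .zero => .zero
  | _, .succ x => .succ (r _ x)

/-- Renaming of free variables. -/
def rename : {k : Kind} → {Γ Δ : List Ty} → (∀ A, Var Γ A → Var Δ A) → Exp k Γ → Exp k Δ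
  | _, _, _, r, lam s => lam (rename (liftRen r) s)
  | _, _, _, r, app s b => app (rename r s) (rename r b)
  | _, _, _, r, var x c => var (r _ x) (rename r c)
  | _, _, _, _, bnil => bnil
  | _, _, _, r, bcons s b => bcons (rename r s) (rename r b)
  | _, _, _, _, snil => snil
  | _, _, _, r, scons b c => scons (rename r b) (rename r c)

/-- Weakening by a fresh variable. -/
def weaken {k : Kind} {Γ : List Ty} {B : Ty} (e : Exp k Γ) : Exp k (B :: Γ) :=
  rename (fun _ x => x.succ) e

/-- The iterated application `s b₁ ⋯ bₙ` of a term to a sequence of bags. -/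
def apps {Γ : List Ty} {B : Ty} :
    (As : List Ty) → Exp (.tm (arrs As B)) Γ → Exp (.sq As) Γ → Exp (.tm B) Γ
  | [], s, .snil => s
  | _ :: As, s, .scons b c => apps As (app s b) c

/-- The bag of the elements of an enumeration. -/
def elems {Γ : List Ty} {A : Ty} : Exp (.bg A) Γ → Multiset (Exp (.tm A) Γ)
  | .bnil => 0
  | .bcons s b => s ::ₘ elems b

end Exp

/-- `Ins A Γ Ξ`: the context `Ξ` is `Γ` with one additional variable of type `A`, inserted at some
position. -/
inductive Ins (A : Ty) : List Ty → List Ty → Type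
  | here {Γ : List Ty} : Ins A Γ (A :: Γ)
  | there {Γ Ξ : List Ty} {B : Ty} : Ins A Γ Ξ → Ins A (B :: Γ) (B :: Ξ)

/-- A variable of `Ξ` either is the inserted one, or comes from a variable of `Γ`. -/
def Ins.compare {A : Ty} : {Γ Ξ : List Ty} → Ins A Γ Ξ → {B : Ty} → Var Ξ B → (A = B) ⊕' Var Γ B
  | _, _, .here, _, .zero => .inl rfl
  | _, _, .here, _, .succ x => .inr x
  | _, _, .there _, _, .zero => .inr .zero
  | _, _, .there i, _, .succ x =>
    match Ins.compare i x with
    | .inl h => .inl h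
    | .inr y => .inr y.succ

namespace Exp

/-- Resource substitution of a bag for the variable `x` designated by `i`. Finite formal sums are
multisets; `Multiset.antidiagonal b` lists, with multiplicities, the `2 ^ card b` ways to partition
`b` into two bags, and partitions into `n` bags are obtained by iteration. A head occurrence of `x`
receives exactly one element of the bag, and a head occurrence of another variable none. -/
def subst {A : Ty} : {k : Kind} → {Γ Ξ : List Ty} → Ins A Γ Ξ → Exp k Ξ →
    Multiset (Exp (.tm A) Γ) → Multiset (Exp k Γ)
  | _, _, _, i, lam s, b => (subst i.there s (b.map weaken)).map lam
  | _, _, _, i, app s c, b =>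
    b.antidiagonal.bind fun p =>
      (subst i s p.1 ×ˢ subst i c p.2).map fun q => app q.1 q.2
  | _, _, _, i, @var _ As y c, b =>
    b.antidiagonal.bind fun p =>
      match i.compare y with
      | .inl h =>
        if p.1.card = 1 then
          (p.1 ×ˢ subst i c p.2).map fun q => apps As (h ▸ q.1) q.2
        else 0
      | .inr z => if p.1.card = 0 then (subst i c p.2).map (var z) else 0
  | _, _, _, _, bnil, b => if b.card = 0 then {bnil} else 0
  | _, _, _, i, bcons s c, b =>
    b.antidiagonal.bind fun p =>
      (subst i s p.1 ×ˢ subst i c p.2).map fun q => bcons q.1 q.2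
  | _, _, _, _, snil, b => if b.card = 0 then {snil} else 0
  | _, _, _, i, scons d c, b =>
    b.antidiagonal.bind fun p =>
      (subst i d p.1 ×ˢ subst i c p.2).map fun q => scons q.1 q.2

/-- One-step resource reduction of an expression to a finite formal sum of expressions. -/
inductive Step : {k : Kind} → {Γ : List Ty} → Exp k Γ → Multiset (Exp k Γ) → Prop
  | beta {Γ : List Ty} {A B : Ty} (s : Exp (.tm B) (A :: Γ)) (b : Exp (.bg A) Γ) :
      Step (app (lam s) b) (subst .here s b.elems)
  | lam {Γ : List Ty} {A B : Ty} {s : Exp (.tm B) (A :: Γ)} {S : Multiset (Exp (.tm B) (A :: Γ))} :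
      Step s S → Step (lam s) (S.map lam)
  | appFun {Γ : List Ty} {A B : Ty} {s : Exp (.tm (.arr A B)) Γ}
      {S : Multiset (Exp (.tm (.arr A B)) Γ)} (b : Exp (.bg A) Γ) :
      Step s S → Step (app s b) (S.map fun s' => app s' b)
  | appArg {Γ : List Ty} {A B : Ty} (s : Exp (.tm (.arr A B)) Γ) {b : Exp (.bg A) Γ}
      {T : Multiset (Exp (.bg A) Γ)} :
      Step b T → Step (app s b) (T.map fun b' => app s b')
  | var {Γ : List Ty} {As : List Ty} (x : Var Γ (arrs As .base)) {c : Exp (.sq As) Γ}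
      {T : Multiset (Exp (.sq As) Γ)} :
      Step c T → Step (var x c) (T.map (var x))
  | bagHead {Γ : List Ty} {A : Ty} {s : Exp (.tm A) Γ} {S : Multiset (Exp (.tm A) Γ)}
      (b : Exp (.bg A) Γ) :
      Step s S → Step (bcons s b) (S.map fun s' => bcons s' b)
  | bagTail {Γ : List Ty} {A : Ty} (s : Exp (.tm A) Γ) {b : Exp (.bg A) Γ}
      {T : Multiset (Exp (.bg A) Γ)} :
      Step b T → Step (bcons s b) (T.map fun b' => bcons s b')
  | seqHead {Γ : List Ty} {A : Ty} {As : List Ty} {b : Exp (.bg A) Γ}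
      {T : Multiset (Exp (.bg A) Γ)} (c : Exp (.sq As) Γ) :
      Step b T → Step (scons b c) (T.map fun b' => scons b' c)
  | seqTail {Γ : List Ty} {A : Ty} {As : List Ty} (b : Exp (.bg A) Γ) {c : Exp (.sq As) Γ}
      {T : Multiset (Exp (.sq As) Γ)} :
      Step c T → Step (scons b c) (T.map fun c' => scons b c')

/-- Expressions up to the order of the elements in bags. -/
instance setoid (k : Kind) (Γ : List Ty) : Setoid (Exp k Γ) where
  r := Eqv
  iseqv := ⟨Eqv.refl, Eqv.symm, Eqv.trans⟩

end Exp

/-- Resource terms of type `A` in context `Γ`, where bags are multisets. -/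
def Tm (Γ : List Ty) (A : Ty) : Type := Quotient (Exp.setoid (.tm A) Γ)

/-- Reduction of a term to a finite formal sum of terms. -/
def Tm.Step {Γ : List Ty} {A : Ty} (s : Tm Γ A) (S : Multiset (Tm Γ A)) : Prop :=
  ∃ (e : Exp (.tm A) Γ) (E : Multiset (Exp (.tm A) Γ)),
    e.Step E ∧ s = Quotient.mk _ e ∧ S = E.map (Quotient.mk _)

/-- Reduction of finite formal sums of terms: one summand is reduced. -/
def SumStep {Γ : List Ty} {A : Ty} (S S' : Multiset (Tm Γ A)) : Prop :=
  ∃ (s : Tm Γ A) (T U : Multiset (Tm Γ A)), s.Step T ∧ S = {s} + U ∧ S' = T + U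

/-! ### Resource categories -/

universe v u

/-- Additive symmetric monoidal categories: hom-sets are commutative monoids, and composition and
tensor product are additive in each argument. -/
class AdditiveSMC (C : Type u) [Category.{v} C] [MonoidalCategory C] [SymmetricCategory C] where
  homAddCommMonoid : ∀ X Y : C, AddCommMonoid (X ⟶ Y)
  add_comp : ∀ {X Y Z : C} (f g : X ⟶ Y) (h : Y ⟶ Z), (f + g) ≫ h = f ≫ h + g ≫ h
  comp_add : ∀ {X Y Z : C} (f : X ⟶ Y) (g h : Y ⟶ Z), f ≫ (g + h) = f ≫ g + f ≫ h
  zero_comp : ∀ {X Y Z : C} (h : Y ⟶ Z), (0 : X ⟶ Y) ≫ h = 0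
  comp_zero : ∀ {X Y Z : C} (f : X ⟶ Y), f ≫ (0 : Y ⟶ Z) = 0
  add_tensor : ∀ {X Y X' Y' : C} (f g : X ⟶ Y) (h : X' ⟶ Y'),
    (f + g) ⊗ₘ h = (f ⊗ₘ h) + (g ⊗ₘ h)
  tensor_add : ∀ {X Y X' Y' : C} (f : X ⟶ Y) (g h : X' ⟶ Y'),
    f ⊗ₘ (g + h) = (f ⊗ₘ g) + (f ⊗ₘ h)
  zero_tensor : ∀ {X Y X' Y' : C} (h : X' ⟶ Y'), (0 : X ⟶ Y) ⊗ₘ h = 0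
  tensor_zero : ∀ {X Y X' Y' : C} (f : X ⟶ Y), f ⊗ₘ (0 : X' ⟶ Y') = 0

attribute [reducible, instance] AdditiveSMC.homAddCommMonoid

/-- Resource categories. -/
class ResourceCategory (C : Type u) [Category.{v} C] [MonoidalCategory C] [SymmetricCategory C]
    extends AdditiveSMC C where
  /-- comultiplication -/
  δ : ∀ A : C, A ⟶ A ⊗ A
  /-- counit -/
  ε : ∀ A : C, A ⟶ 𝟙_ C
  /-- multiplication -/
  μ : ∀ A : C, A ⊗ A ⟶ A
  /-- unit -/
  η : ∀ A : C, 𝟙_ C ⟶ A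
  /-- pointed identity -/
  pid : ∀ A : C, A ⟶ A
  -- commutative monoid
  mul_assoc : ∀ A : C, (μ A ▷ A) ≫ μ A = (α_ A A A).hom ≫ (A ◁ μ A) ≫ μ A
  one_mul : ∀ A : C, (η A ▷ A) ≫ μ A = (λ_ A).hom
  mul_one : ∀ A : C, (A ◁ η A) ≫ μ A = (ρ_ A).hom
  mul_comm : ∀ A : C, (β_ A A).hom ≫ μ A = μ A
  -- commutative comonoid
  comul_assoc : ∀ A : C, δ A ≫ (A ◁ δ A) = δ A ≫ (δ A ▷ A) ≫ (α_ A A A).hom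
  counit_comul : ∀ A : C, δ A ≫ (ε A ▷ A) = (λ_ A).inv
  comul_counit : ∀ A : C, δ A ≫ (A ◁ ε A) = (ρ_ A).inv
  comul_comm : ∀ A : C, δ A ≫ (β_ A A).hom = δ A
  -- bialgebra laws
  mul_comul : ∀ A : C, μ A ≫ δ A = (δ A ⊗ₘ δ A) ≫ tensorμ A A A A ≫ (μ A ⊗ₘ μ A)
  one_comul : ∀ A : C, η A ≫ δ A = (λ_ (𝟙_ C)).inv ≫ (η A ⊗ₘ η A)
  mul_counit : ∀ A : C, μ A ≫ ε A = (ε A ⊗ₘ ε A) ≫ (λ_ (𝟙_ C)).hom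
  one_counit : ∀ A : C, η A ≫ ε A = 𝟙 (𝟙_ C)
  -- compatibility of comonoids with the monoidal structure
  comul_tensor : ∀ A B : C, δ (A ⊗ B) = (δ A ⊗ₘ δ B) ≫ tensorμ A A B B
  counit_tensor : ∀ A B : C, ε (A ⊗ B) = (ε A ⊗ₘ ε B) ≫ (λ_ (𝟙_ C)).hom
  counit_unit : ε (𝟙_ C) = 𝟙 (𝟙_ C)
  -- compatibility of monoids with the monoidal structure
  mul_tensor : ∀ A B : C, μ (A ⊗ B) = tensorμ A B A B ≫ (μ A ⊗ₘ μ B)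
  one_tensor : ∀ A B : C, η (A ⊗ B) = (λ_ (𝟙_ C)).inv ≫ (η A ⊗ₘ η B)
  one_unit : η (𝟙_ C) = 𝟙 (𝟙_ C)
  -- laws of the pointed identity
  pid_idem : ∀ A : C, pid A ≫ pid A = pid A
  pid_comul : ∀ A : C, pid A ≫ δ A =
    (ρ_ A).inv ≫ (pid A ⊗ₘ η A) + (λ_ A).inv ≫ (η A ⊗ₘ pid A)
  mul_pid : ∀ A : C, μ A ≫ pid A =
    (pid A ⊗ₘ ε A) ≫ (ρ_ A).hom + (ε A ⊗ₘ pid A) ≫ (λ_ A).hom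
  pid_counit : ∀ A : C, pid A ≫ ε A = 0
  one_pid : ∀ A : C, η A ≫ pid A = 0

/-- Closed resource categories: each functor `- ⊗ A` has a right adjoint `A ⇒ -`. -/
class ClosedResourceCategory (C : Type u) [Category.{v} C] [MonoidalCategory C]
    [SymmetricCategory C] extends ResourceCategory C where
  /-- the functor `A ⇒ -` -/
  exp : C → C ⥤ C
  /-- the adjunction -/
  expAdj : ∀ A : C, tensorRight A ⊣ exp A

open ResourceCategory ClosedResourceCategory

section Combinators

variable {C : Type u} [Category.{v} C] [MonoidalCategory C] [SymmetricCategory C]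

section

variable [ResourceCategory C]

/-- Pointed morphisms. -/
def IsPointed {X Y : C} (f : X ⟶ Y) : Prop := f ≫ pid Y = f

/-- The pairing `⟨f, g⟩`. -/
def pair {X A B : C} (f : X ⟶ A) (g : X ⟶ B) : X ⟶ A ⊗ B := δ X ≫ (f ⊗ₘ g)

/-- First projection. -/
def proj₁ (A B : C) : A ⊗ B ⟶ A := (A ◁ ε B) ≫ (ρ_ A).hom

/-- Second projection. -/
def proj₂ (A B : C) : A ⊗ B ⟶ B := (ε A ▷ B) ≫ (λ_ B).hom

/-- The product `f * g` of two parallel morphisms. -/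
def prod {X Y : C} (f g : X ⟶ Y) : X ⟶ Y := δ X ≫ (f ⊗ₘ g) ≫ μ Y

theorem prod_comm {X Y : C} (f g : X ⟶ Y) : prod f g = prod g f := by
  unfold prod
  conv_lhs => rw [← comul_comm X, Category.assoc, ← BraidedCategory.braiding_naturality_assoc,
    mul_comm Y]

theorem prod_assoc {X Y : C} (f g h : X ⟶ Y) : prod (prod f g) h = prod f (prod g h) := by
  let _ : ComonObj X :=
    { counit := ε X, comul := δ X, counit_comul := counit_comul X
      comul_counit := comul_counit X, comul_assoc := comul_assoc X }
  let _ : MonObj Y :=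
    { one := η Y, mul := μ Y, one_mul := one_mul Y, mul_one := mul_one Y, mul_assoc := mul_assoc Y }
  have key : ∀ a b : X ⟶ Y, prod a b = @HMul.hMul (Conv X Y) (Conv X Y) (Conv X Y) _ a b := by
    intro a b
    unfold prod
    rw [MonoidalCategory.tensorHom_def, Category.assoc]
    rfl
  rw [key, key, key, key]
  exact _root_.mul_assoc (G := Conv X Y) f g h

instance {X Y : C} : LeftCommutative (prod : (X ⟶ Y) → (X ⟶ Y) → (X ⟶ Y)) where
  left_comm f g h := by rw [← prod_assoc, prod_comm f g, prod_assoc]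

/-- The product of a bag of parallel morphisms; the product of the empty bag is `η ∘ ε`. -/
def bagProd {X Y : C} (F : Multiset (X ⟶ Y)) : X ⟶ Y := F.foldr prod (ε X ≫ η Y)

end

variable [ClosedResourceCategory C]

/-- Currying. -/
def curry {X A B : C} (f : X ⊗ A ⟶ B) : X ⟶ (exp A).obj B := (expAdj A).homEquiv X B f

/-- Evaluation. -/
def ev (A B : C) : (exp A).obj B ⊗ A ⟶ B := ((expAdj A).homEquiv _ B).symm (𝟙 _)

/-! ### Interpretation -/

/-- Interpretation of types. -/
def Ty.obj (o : C) : Ty → C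
  | .base => o
  | .arr A B => (exp (A.obj o)).obj (B.obj o)

/-- Interpretation of contexts; the isomorphism between the interpretations of `Γ, x : A` and of
`Γ` tensored with that of `A` is then an identity. -/
def ctxObj (o : C) : List Ty → C
  | [] => 𝟙_ C
  | A :: Γ => ctxObj o Γ ⊗ A.obj o

/-- Interpretation of tuples of types. -/
def seqObj (o : C) : List Ty → C
  | [] => 𝟙_ C
  | A :: As => A.obj o ⊗ seqObj o As

/-- The projection of a context on a variable. -/
def Var.proj (o : C) : {Γ : List Ty} → {A : Ty} → Var Γ A → (ctxObj o Γ ⟶ A.obj o)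
  | _, _, .zero => proj₂ _ _
  | _, _, .succ x => proj₁ _ _ ≫ Var.proj o x

/-- The isomorphism from `A₁ ⇒ (⋯ ⇒ (Aₙ ⇒ o))` to `(A₁ ⊗ ⋯ ⊗ Aₙ) ⇒ o` obtained from currying and
associativity. -/
def uncurrySeq (o : C) :
    (As : List Ty) → ((arrs As .base).obj o ⟶ (exp (seqObj o As)).obj o)
  | [] => curry (ρ_ _).hom
  | A :: As =>
    curry ((α_ ((exp (A.obj o)).obj ((arrs As .base).obj o)) (A.obj o) (seqObj o As)).inv ≫
      (ev (A.obj o) ((arrs As .base).obj o) ▷ seqObj o As) ≫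
      (uncurrySeq o As ▷ seqObj o As) ≫ ev (seqObj o As) o)

/-- Tuples of bags of morphisms. -/
def SeqSem (o X : C) : List Ty → Type v
  | [] => PUnit
  | A :: As => Multiset (X ⟶ A.obj o) × SeqSem o X As

/-- The sets where expressions are interpreted: morphisms, bags of morphisms and tuples of bags of
morphisms. -/
def Sem (o X : C) : Kind → Type v
  | .tm A => X ⟶ A.obj o
  | .bg A => Multiset (X ⟶ A.obj o)
  | .sq As => SeqSem o X As

/-- The packing of a tuple of bags of morphisms. -/
def pack (o X : C) : (As : List Ty) → SeqSem o X As → (X ⟶ seqObj o As)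
  | [], _ => ε X
  | _ :: As, f => pair (bagProd f.1) (pack o X As f.2)

/-- Interpretation of expressions. -/
def Exp.interp (o : C) : {k : Kind} → {Γ : List Ty} → Exp k Γ → Sem o (ctxObj o Γ) k
  | _, _, .lam s => curry (Exp.interp o s)
  | _, _, .app (A := A) (B := B) s b =>
    pair (Exp.interp o s) (bagProd (Exp.interp o b)) ≫ ev (A.obj o) (B.obj o)
  | _, _, .var (As := As) x c =>
    pair (x.proj o ≫ uncurrySeq o As ≫ pid _) (pack o _ As (Exp.interp o c)) ≫
      ev (seqObj o As) o
  | _, _, .bnil (A := A) => (0 : Multiset (_ ⟶ A.obj o))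
  | _, _, .bcons (A := A) s b =>
    Multiset.cons (α := _ ⟶ A.obj o) (Exp.interp o s) (Exp.interp o b)
  | _, _, .snil => PUnit.unit
  | _, _, .scons b c => (Exp.interp o b, Exp.interp o c)

theorem Exp.interp_eqv (o : C) {k : Kind} {Γ : List Ty} {e e' : Exp k Γ} (h : Exp.Eqv e e') :
    e.interp o = e'.interp o := by
  induction h with
  | refl e => rfl
  | symm _ ih => exact ih.symm
  | trans _ _ ih ih' => exact ih.trans ih'
  | swap s t b => exact Multiset.cons_swap _ _ _
  | _ => (simp_all only [Exp.interp]; rfl)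

/-- Interpretation of terms. -/
def Tm.interp (o : C) {Γ : List Ty} {A : Ty} (s : Tm Γ A) : ctxObj o Γ ⟶ A.obj o :=
  Quotient.lift (s := Exp.setoid (.tm A) Γ) (fun e => (e.interp o : ctxObj o Γ ⟶ A.obj o))
    (fun _ _ h => Exp.interp_eqv o h) s

/-- Interpretation of finite formal sums of terms. -/
def sumInterp (o : C) {Γ : List Ty} {A : Ty} (S : Multiset (Tm Γ A)) : ctxObj o Γ ⟶ A.obj o :=
  (S.map (Tm.interp o)).sum

end Combinators

end ResourceCalculus

open ResourceCalculus

namespace ResourceCalculus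

open ResourceCategory ClosedResourceCategory AdditiveSMC

/-! ### Calculus of pairings, erasure and copying in a resource category. -/

section Pairing

variable {C : Type u} [Category.{v} C] [MonoidalCategory C] [SymmetricCategory C]
  [ResourceCategory C]

/-! A product of a bag `F` of pointed morphisms is a resource that must be used exactly once per
element. By the bialgebra laws and the laws of `pid`, copying it gives the sum over all splittings
of `F` in two (`bagProd_comul`), erasing it gives zero unless `F` is empty (`bagProd_counit`), and
applying `pid` gives zero unless `F` is a singleton, in which case its element comes out
(`bagProd_pid`). These mirror the clauses of resource substitution: the bag is shared out among
subexpressions, nothing may remain at a leaf or at another variable, and a head occurrence takes one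
element.

The core is therefore the substitution lemma `bagSub_comp_denote`, proved by induction on
expressions of all kinds at once. For this, `Exp.denote` packs bags into products and sequences into
pairings, so that every binary constructor is a pairing followed by a fixed morphism. To pass under
binders, the variable substituted for sits at an arbitrary position of the context, while the bag
stays in the part of the context below it.

Compatibility of `pid` with currying enters twice. It makes all terms pointed
(`Exp.isPointed_denote`), so that the three bag laws apply, and it makes `pid` commute with
`uncurrySeq`, so that at a head variable `pid` meets the bag product directly. A β-step is the
substitution lemma at the outermost variable after `pair_curry_ev`; closure under contexts and sums
is additivity. -/

theorem pair_tensor {X A B A' B' : C} (f : X ⟶ A) (g : X ⟶ B) (h : A ⟶ A') (k : B ⟶ B') :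
    pair f g ≫ (h ⊗ₘ k) = pair (f ≫ h) (g ≫ k) := by
  simp [pair]

theorem pair_tensor_assoc {X A B A' B' Z : C} (f : X ⟶ A) (g : X ⟶ B) (h : A ⟶ A') (k : B ⟶ B')
    (m : A' ⊗ B' ⟶ Z) : pair f g ≫ (h ⊗ₘ k) ≫ m = pair (f ≫ h) (g ≫ k) ≫ m := by
  rw [← Category.assoc, pair_tensor]

theorem pair_whiskerRight {X A B A' : C} (f : X ⟶ A) (g : X ⟶ B) (h : A ⟶ A') :
    pair f g ≫ (h ▷ B) = pair (f ≫ h) g := by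
  rw [← tensorHom_id, pair_tensor, Category.comp_id]

theorem pair_whiskerRight_assoc {X A B A' Z : C} (f : X ⟶ A) (g : X ⟶ B) (h : A ⟶ A')
    (m : A' ⊗ B ⟶ Z) : pair f g ≫ (h ▷ B) ≫ m = pair (f ≫ h) g ≫ m := by
  rw [← Category.assoc, pair_whiskerRight]

theorem pair_whiskerLeft {X A B B' : C} (f : X ⟶ A) (g : X ⟶ B) (k : B ⟶ B') :
    pair f g ≫ (A ◁ k) = pair f (g ≫ k) := by
  rw [← id_tensorHom, pair_tensor, Category.comp_id]

theorem pair_whiskerLeft_assoc {X A B B' Z : C} (f : X ⟶ A) (g : X ⟶ B) (k : B ⟶ B')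
    (m : A ⊗ B' ⟶ Z) : pair f g ≫ (A ◁ k) ≫ m = pair f (g ≫ k) ≫ m := by
  rw [← Category.assoc, pair_whiskerLeft]

theorem pair_associator {X A B D : C} (f : X ⟶ A) (g : X ⟶ B) (h : X ⟶ D) :
    pair (pair f g) h ≫ (α_ A B D).hom = pair f (pair g h) := by
  have h1 : pair (pair f g) h = δ X ≫ (δ X ▷ X) ≫ ((f ⊗ₘ g) ⊗ₘ h) := by
    rw [← tensorHom_id, tensorHom_comp_tensorHom, Category.id_comp, pair, pair]
  have h2 : pair f (pair g h) = δ X ≫ (X ◁ δ X) ≫ (f ⊗ₘ (g ⊗ₘ h)) := by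
    rw [← id_tensorHom, tensorHom_comp_tensorHom, Category.id_comp, pair, pair]
  rw [h1, h2, Category.assoc, Category.assoc, associator_naturality, ← Category.assoc (δ X) (X ◁ _),
    comul_assoc, Category.assoc, Category.assoc]

theorem pair_associator_assoc {X A B D Z : C} (f : X ⟶ A) (g : X ⟶ B) (h : X ⟶ D)
    (m : A ⊗ B ⊗ D ⟶ Z) :
    pair (pair f g) h ≫ (α_ A B D).hom ≫ m = pair f (pair g h) ≫ m := by
  rw [← Category.assoc, pair_associator]

theorem pair_associator_inv {X A B D : C} (f : X ⟶ A) (g : X ⟶ B) (h : X ⟶ D) :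
    pair f (pair g h) ≫ (α_ A B D).inv = pair (pair f g) h := by
  rw [← pair_associator, Category.assoc, Iso.hom_inv_id, Category.comp_id]

theorem pair_associator_inv_assoc {X A B D Z : C} (f : X ⟶ A) (g : X ⟶ B) (h : X ⟶ D)
    (m : (A ⊗ B) ⊗ D ⟶ Z) :
    pair f (pair g h) ≫ (α_ A B D).inv ≫ m = pair (pair f g) h ≫ m := by
  rw [← Category.assoc, pair_associator_inv]

theorem pair_braiding {X A B : C} (f : X ⟶ A) (g : X ⟶ B) :
    pair f g ≫ (β_ A B).hom = pair g f := by
  rw [pair, Category.assoc, BraidedCategory.braiding_naturality, ← Category.assoc, comul_comm, pair]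

theorem pair_tensorμ {X A B A' B' : C} (f : X ⟶ A) (g : X ⟶ B) (f' : X ⟶ A') (g' : X ⟶ B') :
    pair (pair f g) (pair f' g') ≫ tensorμ A B A' B' = pair (pair f f') (pair g g') := by
  rw [tensorμ, pair_associator_assoc, pair_whiskerLeft_assoc, pair_associator_inv,
    pair_whiskerLeft_assoc, pair_whiskerRight, pair_braiding, pair_whiskerLeft_assoc,
    pair_associator, pair_associator_inv]

theorem pair_tensorμ_assoc {X A B A' B' Z : C} (f : X ⟶ A) (g : X ⟶ B) (f' : X ⟶ A')
    (g' : X ⟶ B') (m : (A ⊗ A') ⊗ B ⊗ B' ⟶ Z) :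
    pair (pair f g) (pair f' g') ≫ tensorμ A B A' B' ≫ m =
      pair (pair f f') (pair g g') ≫ m := by
  rw [← Category.assoc, pair_tensorμ]

theorem comul_eq_pair (X : C) : δ X = pair (𝟙 X) (𝟙 X) := by simp [pair]

theorem pair_counit_right {X A : C} (f : X ⟶ A) : pair f (ε X) ≫ (ρ_ A).hom = f := by
  have : pair f (ε X) = δ X ≫ (X ◁ ε X) ≫ (f ▷ _) := by
    rw [pair, tensorHom_def']
  rw [this, ← Category.assoc (δ X), comul_counit]
  simp

theorem pair_counit_left {X A : C} (f : X ⟶ A) : pair (ε X) f ≫ (λ_ A).hom = f := by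
  have : pair (ε X) f = δ X ≫ (ε X ▷ X) ≫ (_ ◁ f) := by
    rw [pair, MonoidalCategory.tensorHom_def]
  rw [this, ← Category.assoc (δ X), counit_comul]
  simp

theorem comp_rightUnitor_inv {X A : C} (f : X ⟶ A) : f ≫ (ρ_ A).inv = pair f (ε X) := by
  rw [Iso.comp_inv_eq, pair_counit_right]

theorem comp_leftUnitor_inv {X A : C} (f : X ⟶ A) : f ≫ (λ_ A).inv = pair (ε X) f := by
  rw [Iso.comp_inv_eq, pair_counit_left]

theorem prod_eq_pair {X Y : C} (f g : X ⟶ Y) : prod f g = pair f g ≫ μ Y := by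
  simp [prod, pair]

theorem one_prod {X Y : C} (f : X ⟶ Y) : prod (ε X ≫ η Y) f = f := by
  rw [prod_eq_pair, ← pair_whiskerRight, Category.assoc, ResourceCategory.one_mul,
    pair_counit_left]

/-! #### Additivity -/

theorem add_pair {X A B : C} (f f' : X ⟶ A) (g : X ⟶ B) :
    pair (f + f') g = pair f g + pair f' g := by
  simp only [pair, add_tensor, comp_add]

theorem pair_add {X A B : C} (f : X ⟶ A) (g g' : X ⟶ B) :
    pair f (g + g') = pair f g + pair f g' := by
  simp only [pair, tensor_add, comp_add]

theorem zero_pair {X A B : C} (g : X ⟶ B) : pair (0 : X ⟶ A) g = 0 := by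
  simp only [pair, zero_tensor, comp_zero]

theorem pair_zero {X A B : C} (f : X ⟶ A) : pair f (0 : X ⟶ B) = 0 := by
  simp only [pair, tensor_zero, comp_zero]

theorem sum_comp {ι : Type*} {X Y Z : C} (s : Multiset ι) (f : ι → (X ⟶ Y)) (h : Y ⟶ Z) :
    (s.map f).sum ≫ h = (s.map fun i => f i ≫ h).sum := by
  induction s using Multiset.induction_on with
  | empty => simp [zero_comp]
  | cons a s ih => simp [add_comp, ih]

theorem comp_sum {ι : Type*} {X Y Z : C} (h : X ⟶ Y) (s : Multiset ι) (f : ι → (Y ⟶ Z)) :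
    h ≫ (s.map f).sum = (s.map fun i => h ≫ f i).sum := by
  induction s using Multiset.induction_on with
  | empty => simp [comp_zero]
  | cons a s ih => simp [comp_add, ih]

theorem sum_tensor {ι : Type*} {X Y X' Y' : C} (s : Multiset ι) (f : ι → (X ⟶ Y)) (h : X' ⟶ Y') :
    (s.map f).sum ⊗ₘ h = (s.map fun i => f i ⊗ₘ h).sum := by
  induction s using Multiset.induction_on with
  | empty => simp [zero_tensor]
  | cons a s ih => simp [add_tensor, ih]

theorem sum_pair {ι : Type*} {X A B : C} (s : Multiset ι) (f : ι → (X ⟶ A)) (g : X ⟶ B) :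
    pair (s.map f).sum g = (s.map fun i => pair (f i) g).sum := by
  induction s using Multiset.induction_on with
  | empty => simp [zero_pair]
  | cons a s ih => simp [add_pair, ih]

theorem pair_sum {ι : Type*} {X A B : C} (f : X ⟶ A) (s : Multiset ι) (g : ι → (X ⟶ B)) :
    pair f (s.map g).sum = (s.map fun i => pair f (g i)).sum := by
  induction s using Multiset.induction_on with
  | empty => simp [pair_zero]
  | cons a s ih => simp [pair_add, ih]

theorem sum_pair_sum {ι κ : Type*} {X A B : C} (s : Multiset ι) (t : Multiset κ)
    (f : ι → (X ⟶ A)) (g : κ → (X ⟶ B)) :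
    pair (s.map f).sum (t.map g).sum =
      ((s ×ˢ t).map fun q : ι × κ => pair (f q.1) (g q.2)).sum := by
  rw [sum_pair]
  simp only [SProd.sprod, Multiset.product, Multiset.map_bind, Multiset.sum_bind, Multiset.map_map,
    Function.comp_def, pair_sum]

theorem sum_pair_sum_comp {ι κ : Type*} {X A B Z : C} (s : Multiset ι) (t : Multiset κ)
    (f : ι → (X ⟶ A)) (g : κ → (X ⟶ B)) (m : A ⊗ B ⟶ Z) :
    pair (s.map f).sum (t.map g).sum ≫ m =
      ((s ×ˢ t).map fun q : ι × κ => pair (f q.1) (g q.2) ≫ m).sum := by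
  rw [sum_pair_sum, sum_comp]

theorem sum_pair_comp {ι : Type*} {X A B Z : C} (s : Multiset ι) (f : ι → (X ⟶ A)) (g : X ⟶ B)
    (m : A ⊗ B ⟶ Z) : pair (s.map f).sum g ≫ m = (s.map fun i => pair (f i) g ≫ m).sum := by
  rw [sum_pair, sum_comp]

theorem pair_sum_comp {ι : Type*} {X A B Z : C} (f : X ⟶ A) (s : Multiset ι) (g : ι → (X ⟶ B))
    (m : A ⊗ B ⟶ Z) : pair f (s.map g).sum ≫ m = (s.map fun i => pair f (g i) ≫ m).sum := by
  rw [pair_sum, sum_comp]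

/-! #### Comonoid morphisms -/

/-- Morphisms of comonoids. -/
structure IsComonoidHom {X Y : C} (h : X ⟶ Y) : Prop where
  comul : h ≫ δ Y = pair h h
  counit : h ≫ ε Y = ε X

theorem IsComonoidHom.comp_pair {X Y A B : C} {h : X ⟶ Y} (hh : IsComonoidHom h)
    (f : Y ⟶ A) (g : Y ⟶ B) : h ≫ pair f g = pair (h ≫ f) (h ≫ g) := by
  rw [pair, ← Category.assoc, hh.comul, pair_tensor]

theorem IsComonoidHom.comp_prod {X Y A : C} {h : X ⟶ Y} (hh : IsComonoidHom h)
    (f g : Y ⟶ A) : h ≫ prod f g = prod (h ≫ f) (h ≫ g) := by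
  rw [prod_eq_pair, prod_eq_pair, ← Category.assoc, hh.comp_pair]

theorem IsComonoidHom.comp_pair_comp {X Y A B Z : C} {h : X ⟶ Y} (hh : IsComonoidHom h)
    (f : Y ⟶ A) (g : Y ⟶ B) (m : A ⊗ B ⟶ Z) :
    h ≫ pair f g ≫ m = pair (h ≫ f) (h ≫ g) ≫ m := by
  rw [← Category.assoc, hh.comp_pair]

theorem comul_counit_counit (X : C) : pair (ε X) (ε X) = ε X ≫ (λ_ (𝟙_ C)).inv := by
  rw [comp_leftUnitor_inv]

/-- If `h` is duplicated as a sum, so is `h ▷ B`. -/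
theorem whiskerRight_comul {ι : Type*} {X Y : C} (B : C) (h : X ⟶ Y) (s : Multiset ι)
    (k l : ι → (X ⟶ Y)) (hh : h ≫ δ Y = (s.map fun i => pair (k i) (l i)).sum) :
    (h ▷ B) ≫ δ (Y ⊗ B) = (s.map fun i => pair (k i ▷ B) (l i ▷ B)).sum := by
  have h1 : (h ▷ B) ≫ δ (Y ⊗ B) = ((h ≫ δ Y) ⊗ₘ δ B) ≫ tensorμ Y Y B B := by
    rw [comul_tensor, ← tensorHom_id, tensorHom_comp_tensorHom_assoc, Category.id_comp]
  rw [h1, hh, sum_tensor, sum_comp]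
  congr 1
  refine Multiset.map_congr rfl fun i _ => ?_
  have h2 : (pair (k i) (l i) ⊗ₘ δ B) = (δ X ⊗ₘ δ B) ≫ ((k i ⊗ₘ l i) ⊗ₘ (𝟙 B ⊗ₘ 𝟙 B)) := by
    rw [tensorHom_comp_tensorHom, id_tensorHom_id, Category.comp_id, pair]
  rw [h2, Category.assoc, tensorμ_natural, pair, comul_tensor, tensorHom_id, tensorHom_id,
    Category.assoc]

theorem whiskerRight_counit {X Y : C} {f : X ⟶ Y} (hf : f ≫ ε Y = ε X) (B : C) :
    (f ▷ B) ≫ ε (Y ⊗ B) = ε (X ⊗ B) := by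
  rw [counit_tensor, counit_tensor, ← tensorHom_id, tensorHom_comp_tensorHom_assoc, hf,
    Category.id_comp]

theorem IsComonoidHom.whiskerRight {X Y : C} {h : X ⟶ Y} (hh : IsComonoidHom h) (B : C) :
    IsComonoidHom (h ▷ B) where
  comul := by
    have := whiskerRight_comul B h {()} (fun _ => h) (fun _ => h) (by simpa using hh.comul)
    simpa using this
  counit := whiskerRight_counit hh.counit B

/-- Erasing both copies of `B` amounts to erasing `B` once. Being copied without creating sums is
what lets weakening commute with every term constructor. -/
theorem proj₁_isComonoidHom (A B : C) : IsComonoidHom (proj₁ A B) where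
  comul := by
    have h1 : pair (proj₁ A B) (proj₁ A B) =
        (δ A ⊗ₘ (δ B ≫ (ε B ⊗ₘ ε B))) ≫ tensorμ A A (𝟙_ C) (𝟙_ C) ≫
          ((ρ_ A).hom ⊗ₘ (ρ_ A).hom) := by
      have h2 : (δ A ⊗ₘ (δ B ≫ (ε B ⊗ₘ ε B))) =
          (δ A ⊗ₘ δ B) ≫ ((𝟙 A ⊗ₘ 𝟙 A) ⊗ₘ (ε B ⊗ₘ ε B)) := by
        rw [tensorHom_comp_tensorHom, id_tensorHom_id, Category.comp_id]
      rw [h2, Category.assoc, tensorμ_natural_assoc, pair, comul_tensor, proj₁]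
      simp
    have h3 : δ B ≫ (ε B ⊗ₘ ε B) = ε B ≫ (λ_ (𝟙_ C)).inv := comul_counit_counit B
    rw [h1, h3, proj₁, Category.assoc, ← rightUnitor_naturality, tensor_right_unitality]
    have h4 : (δ A ⊗ₘ ε B ≫ (λ_ (𝟙_ C)).inv) =
        (A ◁ ε B) ≫ (δ A ▷ 𝟙_ C) ≫ ((A ⊗ A) ◁ (λ_ (𝟙_ C)).inv) := by
      rw [tensorHom_def', MonoidalCategory.whiskerLeft_comp, Category.assoc, whisker_exchange]
    rw [h4, Category.assoc, Category.assoc]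
  counit := by
    rw [proj₁, counit_tensor, Category.assoc, ← rightUnitor_naturality, tensorHom_def',
      Category.assoc, unitors_equal]

theorem proj₁_naturality {X Y : C} (f : X ⟶ Y) (B : C) :
    (f ▷ B) ≫ proj₁ Y B = proj₁ X B ≫ f := by
  rw [proj₁, proj₁, ← whisker_exchange_assoc, rightUnitor_naturality, Category.assoc]

theorem proj₁_naturality_assoc {X Y Z : C} (f : X ⟶ Y) (B : C) (m : Y ⟶ Z) :
    (f ▷ B) ≫ proj₁ Y B ≫ m = proj₁ X B ≫ f ≫ m := by
  rw [← Category.assoc, proj₁_naturality, Category.assoc]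

theorem whiskerRight_proj₂ {X Y : C} (f : X ⟶ Y) (B : C) :
    (f ▷ B) ≫ proj₂ Y B = ((f ≫ ε Y) ▷ B) ≫ (λ_ B).hom := by
  simp [proj₂]

theorem whiskerRight_proj₂_of_counit {X Y : C} {f : X ⟶ Y} (hf : f ≫ ε Y = ε X) (B : C) :
    (f ▷ B) ≫ proj₂ Y B = proj₂ X B := by
  rw [whiskerRight_proj₂, hf, proj₂]

/-- Projecting on `B` erases `Y`, so an `f` that cannot be erased annihilates even the component
that it leaves untouched. -/
theorem whiskerRight_proj₂_of_counit_zero {X Y : C} {f : X ⟶ Y} (hf : f ≫ ε Y = 0) (B : C) :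
    (f ▷ B) ≫ proj₂ Y B = 0 := by
  rw [whiskerRight_proj₂, hf, ← tensorHom_id, zero_tensor, zero_comp]

theorem whiskerRight_counit_zero {X Y : C} {f : X ⟶ Y} (hf : f ≫ ε Y = 0) (B : C) :
    (f ▷ B) ≫ ε (Y ⊗ B) = 0 := by
  rw [counit_tensor, ← tensorHom_id, tensorHom_comp_tensorHom_assoc, hf, zero_tensor, zero_comp]

/-- The ambient context is copied as it is; only `g` contributes a sum. -/
theorem pair_id_comul {ι : Type*} {X A : C} (g : X ⟶ A) (s : Multiset ι) (k l : ι → (X ⟶ A))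
    (hg : g ≫ δ A = (s.map fun i => pair (k i) (l i)).sum) :
    pair (𝟙 X) g ≫ δ (X ⊗ A) = (s.map fun i => pair (pair (𝟙 X) (k i)) (pair (𝟙 X) (l i))).sum := by
  rw [comul_tensor, pair_tensor_assoc, hg, Category.id_comp, comul_eq_pair, pair_sum, sum_comp]
  simp only [pair_tensorμ]

theorem pair_id_counit {X A : C} {g : X ⟶ A} (hg : g ≫ ε A = ε X) :
    pair (𝟙 X) g ≫ ε (X ⊗ A) = ε X := by
  rw [counit_tensor, pair_tensor_assoc, hg, Category.id_comp, pair_counit_left]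

theorem pair_id_counit_zero {X A : C} {g : X ⟶ A} (hg : g ≫ ε A = 0) :
    pair (𝟙 X) g ≫ ε (X ⊗ A) = 0 := by
  rw [counit_tensor, pair_tensor_assoc, hg, pair_zero, zero_comp]

theorem pair_id_proj₁_comp {X A Z : C} {g : X ⟶ A} (hg : g ≫ ε A = ε X) (m : X ⟶ Z) :
    pair (𝟙 X) g ≫ proj₁ X A ≫ m = m := by
  rw [proj₁, Category.assoc, pair_whiskerLeft_assoc, hg, ← Category.assoc, pair_counit_right,
    Category.id_comp]

theorem pair_id_proj₁_comp_zero {X A Z : C} {g : X ⟶ A} (hg : g ≫ ε A = 0) (m : X ⟶ Z) :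
    pair (𝟙 X) g ≫ proj₁ X A ≫ m = 0 := by
  rw [proj₁, Category.assoc, pair_whiskerLeft_assoc, hg, pair_zero, zero_comp]

theorem pair_id_proj₂ {X A : C} (g : X ⟶ A) : pair (𝟙 X) g ≫ proj₂ X A = g := by
  rw [proj₂, pair_whiskerRight_assoc, Category.id_comp, pair_counit_left]

/-! #### Products of bags of pointed morphisms -/

@[simp]
theorem bagProd_zero {X Y : C} : bagProd (0 : Multiset (X ⟶ Y)) = ε X ≫ η Y := rfl

@[simp]
theorem bagProd_cons {X Y : C} (f : X ⟶ Y) (F : Multiset (X ⟶ Y)) :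
    bagProd (f ::ₘ F) = prod f (bagProd F) := Multiset.foldr_cons _ _ _ _

theorem counit_unit_comul (X Y : C) : (ε X ≫ η Y) ≫ δ Y = pair (ε X ≫ η Y) (ε X ≫ η Y) := by
  rw [Category.assoc, one_comul, ← Category.assoc, comp_leftUnitor_inv, pair_tensor]

/-- Pointedness lets `pid` be inserted after `f`, and the law for copying `pid` then says that
exactly one of the two copies receives `f`. -/
theorem IsPointed.comp_comul {X Y : C} {f : X ⟶ Y} (hf : IsPointed f) :
    f ≫ δ Y = pair f (ε X ≫ η Y) + pair (ε X ≫ η Y) f := by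
  conv_lhs => rw [← hf, Category.assoc, pid_comul, comp_add, ← Category.assoc, ← Category.assoc,
    comp_rightUnitor_inv, comp_leftUnitor_inv, pair_tensor, pair_tensor, hf]

theorem IsPointed.comp_counit {X Y : C} {f : X ⟶ Y} (hf : IsPointed f) : f ≫ ε Y = 0 := by
  rw [← hf, Category.assoc, pid_counit, comp_zero]

theorem prod_comul {X Y : C} (f g : X ⟶ Y) :
    prod f g ≫ δ Y = pair (f ≫ δ Y) (g ≫ δ Y) ≫ tensorμ Y Y Y Y ≫ (μ Y ⊗ₘ μ Y) := by
  rw [prod_eq_pair, Category.assoc, mul_comul, pair_tensor_assoc]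

theorem pair_pair_mul {X Y : C} (a b c d : X ⟶ Y) :
    pair (pair a b) (pair c d) ≫ tensorμ Y Y Y Y ≫ (μ Y ⊗ₘ μ Y) =
      pair (prod a c) (prod b d) := by
  rw [pair_tensorμ_assoc, pair_tensor, prod_eq_pair, prod_eq_pair]

/-- Copying is multiplicative by the bialgebra law, and each pointed factor goes wholly to one side;
expanding the product of these binary sums enumerates the splittings. -/
theorem bagProd_comul {X Y : C} (F : Multiset (X ⟶ Y)) (hF : ∀ f ∈ F, IsPointed f) :
    bagProd F ≫ δ Y =
      (F.antidiagonal.map fun p => pair (bagProd p.1) (bagProd p.2)).sum := by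
  induction F using Multiset.induction_on with
  | empty => simpa using counit_unit_comul X Y
  | cons f F ih =>
    have hf := hF f (Multiset.mem_cons_self f F)
    -- The final `add_comm` matches `Multiset.antidiagonal_cons`, which first lists the splittings
    -- sending the new element to the right.
    rw [bagProd_cons, prod_comul, hf.comp_comul,
      ih fun g hg => hF g (Multiset.mem_cons_of_mem hg), add_pair, add_comp, pair_sum, pair_sum,
      sum_comp, sum_comp, add_comm]
    simp only [pair_pair_mul, one_prod, Multiset.antidiagonal_cons, Multiset.map_add,
      Multiset.map_map, Multiset.sum_add, Function.comp_def, Prod.map, id, bagProd_cons]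

theorem prod_counit {X Y : C} (f g : X ⟶ Y) :
    prod f g ≫ ε Y = pair (f ≫ ε Y) (g ≫ ε Y) ≫ (λ_ (𝟙_ C)).hom := by
  rw [prod_eq_pair, Category.assoc, mul_counit, pair_tensor_assoc]

theorem bagProd_counit {X Y : C} (F : Multiset (X ⟶ Y)) (hF : ∀ f ∈ F, IsPointed f) :
    bagProd F ≫ ε Y = if F.card = 0 then ε X else 0 := by
  induction F using Multiset.induction_on with
  | empty => simp [one_counit]
  | cons f F ih =>
    rw [bagProd_cons, prod_counit, (hF f (Multiset.mem_cons_self f F)).comp_counit, zero_pair,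
      zero_comp]
    simp

/-- Applying `pid` to a product keeps one factor and erases the other. A pointed `f` cannot be
erased, so only the term keeping `f` survives, and it requires the rest of the bag to be empty. -/
theorem bagProd_pid {X Y : C} (F : Multiset (X ⟶ Y)) (hF : ∀ f ∈ F, IsPointed f) :
    bagProd F ≫ pid Y = if F.card = 1 then F.sum else 0 := by
  induction F using Multiset.induction_on with
  | empty => simp [one_pid, comp_zero]
  | cons f F ih =>
    have hf := hF f (Multiset.mem_cons_self f F)
    rw [bagProd_cons, prod_eq_pair, Category.assoc, mul_pid, comp_add, pair_tensor_assoc,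
      pair_tensor_assoc, hf.comp_counit, zero_pair, zero_comp, add_zero,
      bagProd_counit F fun g hg => hF g (Multiset.mem_cons_of_mem hg), hf]
    by_cases h : F.card = 0
    · rw [if_pos h, pair_counit_right]
      rw [Multiset.card_eq_zero] at h
      simp [h]
    · rw [if_neg h, pair_zero, zero_comp, if_neg (by simpa using h)]

end Pairing

/-! ### Currying: additivity and pointed identities. -/

section Closed

variable {C : Type u} [Category.{v} C] [MonoidalCategory C] [SymmetricCategory C]
  [ClosedResourceCategory C]

theorem curry_ev {X A B : C} (f : X ⊗ A ⟶ B) : (curry f ▷ A) ≫ ev A B = f := by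
  have := (expAdj A).homEquiv_naturality_left_symm (curry f) (𝟙 ((exp A).obj B))
  rw [Category.comp_id] at this
  exact this.symm.trans (((expAdj A).homEquiv X B).symm_apply_apply f)

theorem comp_curry {X Y A B : C} (h : X ⟶ Y) (f : Y ⊗ A ⟶ B) :
    h ≫ curry f = curry ((h ▷ A) ≫ f) :=
  ((expAdj A).homEquiv_naturality_left h f).symm

theorem curry_uncurry {X A B : C} (g : X ⟶ (exp A).obj B) : curry ((g ▷ A) ≫ ev A B) = g := by
  rw [← comp_curry, curry, ev, Equiv.apply_symm_apply, Category.comp_id]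

/-- The adjunction is not assumed additive, but uncurrying is whiskering followed by composition
with `ev`, both additive, and currying is its inverse. -/
theorem curry_add {X A B : C} (f g : X ⊗ A ⟶ B) : curry (f + g) = curry f + curry g := by
  conv_rhs => rw [← curry_uncurry (curry f + curry g), ← tensorHom_id, add_tensor, add_comp,
    tensorHom_id, tensorHom_id, curry_ev, curry_ev]

theorem curry_zero {X A B : C} : curry (0 : X ⊗ A ⟶ B) = 0 := by
  conv_rhs => rw [← curry_uncurry (0 : X ⟶ (exp A).obj B), ← tensorHom_id, zero_tensor, zero_comp]

theorem curry_sum {ι : Type*} {X A B : C} (s : Multiset ι) (f : ι → (X ⊗ A ⟶ B)) :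
    curry (s.map f).sum = (s.map fun i => curry (f i)).sum := by
  induction s using Multiset.induction_on with
  | empty => simp [curry_zero]
  | cons a s ih => simp [curry_add, ih]

theorem pair_curry_ev {X A B : C} (f : X ⊗ A ⟶ B) (g : X ⟶ A) :
    pair (curry f) g ≫ ev A B = pair (𝟙 X) g ≫ f := by
  have : pair (curry f) g = pair (𝟙 X) g ≫ (curry f ▷ A) := by
    rw [pair_whiskerRight, Category.id_comp]
  rw [this, Category.assoc, curry_ev]

/-- The recursive clause of `uncurrySeq` in action: evaluating at the tuple `g, h` is evaluating at
`g`, then at `h`. -/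
theorem pair_uncurry_ev {X A B S D : C} (f : X ⟶ (exp A).obj B) (g : X ⟶ A) (h : X ⟶ S)
    (u : B ⟶ (exp S).obj D) :
    pair (f ≫ curry ((α_ ((exp A).obj B) A S).inv ≫ (ev A B ▷ S) ≫ (u ▷ S) ≫ ev S D))
      (pair g h) ≫ ev (A ⊗ S) D = pair ((pair f g ≫ ev A B) ≫ u) h ≫ ev S D := by
  rw [← pair_whiskerRight, Category.assoc, curry_ev, pair_associator_inv_assoc,
    pair_whiskerRight_assoc, pair_whiskerRight_assoc]

theorem pair_curry_rightUnitor_ev {X D : C} (f : X ⟶ D) :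
    pair (f ≫ curry (ρ_ D).hom) (ε X) ≫ ev (𝟙_ C) D = f := by
  rw [← pair_whiskerRight, Category.assoc, curry_ev, pair_counit_right]

variable (C) in
/-- Compatibility of the pointed identities with currying. -/
def PidCurry : Prop :=
  ∀ (X A B : C) (f : X ⊗ A ⟶ B), curry f ≫ pid ((exp A).obj B) = curry (f ≫ pid B)

/-- Compatibility with currying, applied to the universal case `curry ev = 𝟙` and uncurried. -/
theorem PidCurry.ev_pid (hp : PidCurry C) (A B : C) :
    ev A B ≫ pid B = (pid ((exp A).obj B) ▷ A) ≫ ev A B := by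
  have h : curry (ev A B) = 𝟙 ((exp A).obj B) := by
    rw [curry, ev, Equiv.apply_symm_apply]
  rw [← curry_ev (ev A B ≫ pid B), ← hp, h, Category.id_comp]

theorem PidCurry.isPointed_pair_ev (hp : PidCurry C) {X A B : C} {f : X ⟶ (exp A).obj B}
    (hf : IsPointed f) (g : X ⟶ A) : IsPointed (pair f g ≫ ev A B) := by
  rw [IsPointed, Category.assoc, hp.ev_pid, pair_whiskerRight_assoc, hf]

theorem isPointed_comp_pid {X Y Z : C} (f : X ⟶ Y) (g : Y ⟶ Z) :
    IsPointed (f ≫ g ≫ pid Z) := by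
  rw [IsPointed, Category.assoc, Category.assoc, pid_idem]

theorem PidCurry.isPointed_curry (hp : PidCurry C) {X A B : C} {f : X ⊗ A ⟶ B}
    (hf : IsPointed f) : IsPointed (curry f) := by
  rw [IsPointed, hp, hf]

theorem PidCurry.uncurry_ev_pid (hp : PidCurry C) {A B S D : C} (u : B ⟶ (exp S).obj D)
    (hu : u ≫ pid _ = pid _ ≫ u) :
    ((α_ ((exp A).obj B) A S).inv ≫ (ev A B ▷ S) ≫ (u ▷ S) ≫ ev S D) ≫ pid D =
      (pid ((exp A).obj B) ▷ (A ⊗ S)) ≫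
        (α_ ((exp A).obj B) A S).inv ≫ (ev A B ▷ S) ≫ (u ▷ S) ≫ ev S D := by
  simp only [Category.assoc]
  rw [hp.ev_pid, ← comp_whiskerRight_assoc u, hu, comp_whiskerRight_assoc,
    ← comp_whiskerRight_assoc _ (pid _), hp.ev_pid, comp_whiskerRight_assoc,
    associator_inv_naturality_left_assoc]

/-- `uncurrySeq` is a curried composite, and `pid` travels backwards through each evaluation onto
the function being evaluated. -/
theorem PidCurry.pid_uncurrySeq (hp : PidCurry C) (o : C) :
    ∀ As : List Ty, uncurrySeq o As ≫ pid _ = pid _ ≫ uncurrySeq o As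
  | [] => by
    refine (hp _ _ _ _).trans ?_
    refine Eq.trans ?_ (comp_curry _ _).symm
    exact congrArg curry (rightUnitor_naturality _).symm
  | A :: As => by
    refine (hp _ _ _ _).trans ?_
    refine Eq.trans ?_ (comp_curry _ _).symm
    exact congrArg curry (hp.uncurry_ev_pid _ (hp.pid_uncurrySeq o As))

end Closed

/-! ### Uniform denotation of terms, bags and sequences. -/

section Denotation

variable {C : Type u} [Category.{v} C] [MonoidalCategory C] [SymmetricCategory C]
  [ClosedResourceCategory C]

/-- Interpretation of kinds by objects. -/
abbrev Kind.obj (o : C) : Kind → C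
  | .tm A => A.obj o
  | .bg A => A.obj o
  | .sq As => seqObj o As

/-- Interpretation of expressions of all kinds by morphisms. -/
def Exp.denote (o : C) : {k : Kind} → {Γ : List Ty} → Exp k Γ → (ctxObj o Γ ⟶ k.obj o)
  | _, _, .lam s => curry (Exp.denote o s)
  | _, _, .app (A := A) (B := B) s b =>
    pair (B := A.obj o) (A := (exp (A.obj o)).obj (B.obj o)) (Exp.denote o s) (Exp.denote o b) ≫
      ev (A.obj o) (B.obj o)
  | _, _, .var (As := As) x c =>
    pair (x.proj o ≫ uncurrySeq o As ≫ pid _) (Exp.denote o c) ≫ ev (seqObj o As) o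
  | _, _, .bnil => ε _ ≫ η _
  | _, _, .bcons (A := A) s b => prod (Y := A.obj o) (Exp.denote o s) (Exp.denote o b)
  | _, _, .snil => ε _
  | _, _, .scons b c => pair (Exp.denote o b) (Exp.denote o c)

/-- The morphism packed in an interpretation. -/
def Sem.pack (o X : C) : (k : Kind) → Sem o X k → (X ⟶ k.obj o)
  | .tm _, f => f
  | .bg _, F => bagProd F
  | .sq As, c => ResourceCalculus.pack o X As c

theorem Exp.pack_interp (o : C) {k : Kind} {Γ : List Ty} (e : Exp k Γ) :
    Sem.pack o (ctxObj o Γ) k (e.interp o) = e.denote o := by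
  induction e with
  | lam s ih => exact congrArg curry ih
  | app s b ihs ihb =>
    exact congrArg₂ (fun f g => pair f g ≫ ev _ _) ihs ihb
  | var x c ih => exact congrArg (fun g => pair _ g ≫ ev _ _) ih
  | bnil => rfl
  | bcons s b ihs ihb => exact (bagProd_cons _ _).trans (congrArg₂ prod ihs ihb)
  | snil => rfl
  | scons b c ihb ihc => exact congrArg₂ pair ihb ihc

theorem Exp.interp_tm (o : C) {A : Ty} {Γ : List Ty} (e : Exp (.tm A) Γ) :
    e.interp o = e.denote o := e.pack_interp o

/-- Interpretation of the elements of a bag. -/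
abbrev bagDenote (o : C) {A : Ty} {Γ : List Ty} (b : Multiset (Exp (.tm A) Γ)) :
    Multiset (ctxObj o Γ ⟶ A.obj o) := b.map fun s => s.denote o

theorem Exp.denote_bag (o : C) {A : Ty} {Γ : List Ty} :
    ∀ b : Exp (.bg A) Γ, b.denote o = bagProd (bagDenote o b.elems)
  | .bnil => by
    have h : bagDenote o (Exp.bnil : Exp (.bg A) Γ).elems = 0 := by
      rw [Exp.elems, bagDenote, Multiset.map_zero]
    rw [h]
    exact bagProd_zero.symm
  | .bcons s b => by
    have h : bagDenote o (Exp.bcons s b).elems = s.denote o ::ₘ bagDenote o b.elems := by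
      rw [Exp.elems]
      exact Multiset.map_cons _ _ _
    rw [h, bagProd_cons]
    exact congrArg (prod _) (denote_bag o b)

/-- Pointedness comes from the body of an abstraction, the function of an application, and the `pid`
at the head of a variable; arguments play no role. -/
theorem Exp.isPointed_denote (hp : PidCurry C) (o : C) :
    {A : Ty} → {Γ : List Ty} → (e : Exp (.tm A) Γ) → IsPointed (e.denote o)
  | _, _, .lam s => hp.isPointed_curry (isPointed_denote hp o s)
  | _, _, .app s b => hp.isPointed_pair_ev (isPointed_denote hp o s) (b.denote o)
  | _, _, .var x c => hp.isPointed_pair_ev (isPointed_comp_pid _ _) (c.denote o)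

theorem isPointed_of_mem_bagDenote (hp : PidCurry C) (o : C) {A : Ty} {Γ : List Ty}
    (b : Multiset (Exp (.tm A) Γ)) : ∀ f ∈ bagDenote o b, IsPointed f := by
  intro f hf
  obtain ⟨s, _, rfl⟩ := Multiset.mem_map.1 hf
  exact s.isPointed_denote hp o

/-! #### Renaming -/

theorem Exp.denote_rename (o : C) {k : Kind} {Γ : List Ty} (e : Exp k Γ) {Δ : List Ty}
    (r : ∀ A, Var Γ A → Var Δ A) (R : ctxObj o Δ ⟶ ctxObj o Γ) (hR : IsComonoidHom R)
    (hr : ∀ A (x : Var Γ A), R ≫ x.proj o = (r A x).proj o) :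
    (e.rename r).denote o = R ≫ e.denote o := by
  induction e generalizing Δ with
  | @lam Γ A B s ih =>
    refine Eq.trans (congrArg curry (ih (liftRen r) (R ▷ A.obj o) (hR.whiskerRight _) ?_))
      (comp_curry _ _).symm
    rintro _ (_ | x)
    · exact whiskerRight_proj₂_of_counit hR.counit _
    · exact (proj₁_naturality_assoc R _ _).trans (congrArg _ (hr _ x))
  | app s b ihs ihb =>
    exact (congrArg₂ (fun f g => pair f g ≫ ev _ _) (ihs r R hR hr) (ihb r R hR hr)).trans
      (hR.comp_pair_comp _ _ _).symm
  | var x c ih =>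
    refine Eq.trans (congrArg₂ (fun f g => pair f g ≫ ev _ _) ?_ (ih r R hR hr))
      (hR.comp_pair_comp _ _ _).symm
    exact (congrArg (· ≫ _) (hr _ x)).symm.trans (Category.assoc _ _ _)
  | bnil => exact (congrArg (· ≫ η _) hR.counit).symm.trans (Category.assoc _ _ _)
  | bcons s b ihs ihb =>
    exact (congrArg₂ prod (ihs r R hR hr) (ihb r R hR hr)).trans (hR.comp_prod _ _).symm
  | snil => exact hR.counit.symm
  | scons b c ihb ihc =>
    exact (congrArg₂ pair (ihb r R hR hr) (ihc r R hR hr)).trans (hR.comp_pair _ _).symm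

theorem Exp.denote_weaken (o : C) {k : Kind} {Γ : List Ty} (B : Ty) (e : Exp k Γ) :
    (e.weaken (B := B)).denote o = proj₁ (ctxObj o Γ) (B.obj o) ≫ e.denote o :=
  e.denote_rename o _ _ (proj₁_isComonoidHom _ _) fun _ _ => rfl

/-! #### Iterated application -/

/-- Needed when substitution replaces a head variable: `uncurrySeq` turns successive evaluations
into one evaluation at the whole tuple. -/
theorem Exp.denote_apps (o : C) {Γ : List Ty} : (As : List Ty) →
    (s : Exp (.tm (arrs As .base)) Γ) → (c : Exp (.sq As) Γ) →
    (apps As s c).denote o =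
      pair (s.denote o ≫ uncurrySeq o As) (c.denote o) ≫ ev (seqObj o As) o
  | [], s, .snil => (pair_curry_rightUnitor_ev (s.denote o)).symm
  | _ :: As, s, .scons b c =>
    (denote_apps o As (app s b) c).trans (pair_uncurry_ev _ _ _ _).symm

end Denotation

/-! ### Substitution -/

namespace Ins

/-- The part of the context below the inserted variable. -/
def base {A : Ty} : {Γ Ξ : List Ty} → Ins A Γ Ξ → List Ty
  | Γ, _, .here => Γ
  | _, _, .there i => i.base

/-- Weakening by the variables above the inserted one. -/
def weak {A : Ty} {k : Kind} : {Γ Ξ : List Ty} → (i : Ins A Γ Ξ) → Exp k i.base → Exp k Γ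
  | _, _, .here, e => e
  | _, _, .there i, e => (i.weak e).weaken

end Ins

section Substitution

variable {C : Type u} [Category.{v} C] [MonoidalCategory C] [SymmetricCategory C]
  [ClosedResourceCategory C]

namespace Ins

/-- The projection on the part of the context below the inserted variable. -/
def drop (o : C) {A : Ty} : {Γ Ξ : List Ty} → (i : Ins A Γ Ξ) → (ctxObj o Γ ⟶ ctxObj o i.base)
  | _, _, .here => 𝟙 _
  | _, _, .there i => proj₁ _ _ ≫ i.drop o

/-- The morphism of contexts instantiating the inserted variable. -/
def sub (o : C) {A : Ty} : {Γ Ξ : List Ty} → (i : Ins A Γ Ξ) → (ctxObj o i.base ⟶ A.obj o) →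
    (ctxObj o Γ ⟶ ctxObj o Ξ)
  | _, _, .here, g => pair (𝟙 _) g
  | _, _, .there i, g => i.sub o g ▷ _

theorem denote_weak (o : C) {A : Ty} {k : Kind} {Γ Ξ : List Ty} (i : Ins A Γ Ξ)
    (e : Exp k i.base) : (i.weak e).denote o = i.drop o ≫ e.denote o := by
  induction i with
  | here => exact (Category.id_comp _).symm
  | there i ih =>
    exact (Exp.denote_weaken o _ _).trans
      ((congrArg (proj₁ _ _ ≫ ·) (ih e)).trans (Category.assoc _ _ _).symm)

/-- The sum over splittings propagates unchanged through the variables above the inserted one, each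
of which is simply copied. -/
theorem sub_comul (o : C) {A : Ty} {Γ Ξ : List Ty} (i : Ins A Γ Ξ) {ι : Type*} (S : Multiset ι)
    (g : ctxObj o i.base ⟶ A.obj o) (k l : ι → (ctxObj o i.base ⟶ A.obj o))
    (hg : g ≫ δ _ = (S.map fun j => pair (k j) (l j)).sum) :
    i.sub o g ≫ δ _ = (S.map fun j => pair (i.sub o (k j)) (i.sub o (l j))).sum := by
  induction i with
  | here => exact pair_id_comul g S k l hg
  | there i ih => exact whiskerRight_comul _ _ S _ _ (ih g k l hg)

theorem sub_counit (o : C) {A : Ty} {Γ Ξ : List Ty} (i : Ins A Γ Ξ)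
    (g : ctxObj o i.base ⟶ A.obj o) (hg : g ≫ ε _ = ε _) : i.sub o g ≫ ε _ = ε _ := by
  induction i with
  | here => exact pair_id_counit hg
  | there i ih => exact whiskerRight_counit (ih g hg) _

theorem sub_counit_zero (o : C) {A : Ty} {Γ Ξ : List Ty} (i : Ins A Γ Ξ)
    (g : ctxObj o i.base ⟶ A.obj o) (hg : g ≫ ε _ = 0) : i.sub o g ≫ ε _ = 0 := by
  induction i with
  | here => exact pair_id_counit_zero hg
  | there i ih => exact whiskerRight_counit_zero (ih g hg) _

/-- No condition on `g` is needed, since this projection erases everything except `g`. -/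
theorem sub_proj_inl (o : C) {A : Ty} {Γ Ξ : List Ty} (i : Ins A Γ Ξ) {B : Ty} (x : Var Ξ B)
    (h : A = B) (hx : i.compare x = .inl h) (g : ctxObj o i.base ⟶ A.obj o) :
    i.sub o g ≫ x.proj o = i.drop o ≫ g ≫ eqToHom (by rw [h]) := by
  subst h
  rw [eqToHom_refl, Category.comp_id]
  induction i with
  | here =>
    cases x with
    | zero => exact (pair_id_proj₂ g).trans (Category.id_comp _).symm
    | succ x => cases hx
  | there i ih =>
    cases x with
    | zero => cases hx
    | succ x =>
      refine (proj₁_naturality_assoc _ _ _).trans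
        ((congrArg (proj₁ _ _ ≫ ·) (ih g x ?_)).trans (Category.assoc _ _ _).symm)
      simp only [Ins.compare] at hx
      split at hx
      · assumption
      · cases hx

theorem sub_proj_inr (o : C) {A : Ty} {Γ Ξ : List Ty} (i : Ins A Γ Ξ) {B : Ty} (x : Var Ξ B)
    (y : Var Γ B) (hx : i.compare x = .inr y) (g : ctxObj o i.base ⟶ A.obj o)
    (hg : g ≫ ε _ = ε _) : i.sub o g ≫ x.proj o = y.proj o := by
  induction i with
  | here =>
    cases x with
    | zero => cases hx
    | succ x =>
      cases hx
      exact pair_id_proj₁_comp hg _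
  | there i ih =>
    cases x with
    | zero =>
      cases hx
      exact whiskerRight_proj₂_of_counit (sub_counit o i g hg) _
    | succ x =>
      simp only [Ins.compare] at hx
      split at hx
      · cases hx
      · rename_i z hz
        cases hx
        exact (proj₁_naturality_assoc _ _ _).trans (congrArg _ (ih x z hz g hg))

/-- Reading another variable erases `g`: resources left over give zero. -/
theorem sub_proj_inr_zero (o : C) {A : Ty} {Γ Ξ : List Ty} (i : Ins A Γ Ξ) {B : Ty} (x : Var Ξ B)
    (y : Var Γ B) (hx : i.compare x = .inr y) (g : ctxObj o i.base ⟶ A.obj o)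
    (hg : g ≫ ε _ = 0) : i.sub o g ≫ x.proj o = 0 := by
  induction i with
  | here =>
    cases x with
    | zero => cases hx
    | succ x => exact pair_id_proj₁_comp_zero hg _
  | there i ih =>
    cases x with
    | zero => exact whiskerRight_proj₂_of_counit_zero (sub_counit_zero o i g hg) _
    | succ x =>
      simp only [Ins.compare] at hx
      split at hx
      · cases hx
      · rename_i z hz
        exact (proj₁_naturality_assoc _ _ _).trans
          ((congrArg (proj₁ _ _ ≫ ·) (ih x z hz g hg)).trans (comp_zero _))

end Ins

end Substitution

theorem antidiagonal_map {α β : Type*} (f : α → β) (s : Multiset α) :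
    (s.map f).antidiagonal = s.antidiagonal.map (Prod.map (Multiset.map f) (Multiset.map f)) := by
  induction s using Multiset.induction_on with
  | empty => simp
  | cons a s ih =>
    simp [ih, Multiset.map_map, Prod.map]

/-! ### The substitution lemma and its consequences. -/

section Soundness

variable {C : Type u} [Category.{v} C] [MonoidalCategory C] [SymmetricCategory C]
  [ClosedResourceCategory C]

/-- The morphism of contexts instantiating the inserted variable by a bag of terms. -/
def Ins.bagSub (o : C) {A : Ty} {Γ Ξ : List Ty} (i : Ins A Γ Ξ)
    (b : Multiset (Exp (.tm A) i.base)) : ctxObj o Γ ⟶ ctxObj o Ξ :=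
  i.sub o (bagProd (bagDenote o b))

/-- Interpretation of finite formal sums of expressions. -/
def sumDenote (o : C) {k : Kind} {Γ : List Ty} (E : Multiset (Exp k Γ)) :
    ctxObj o Γ ⟶ k.obj o :=
  (E.map fun e => e.denote o).sum

theorem Ins.bagSub_comp_pair (hp : PidCurry C) (o : C) {A : Ty} {Γ Ξ : List Ty} (i : Ins A Γ Ξ)
    (b : Multiset (Exp (.tm A) i.base)) {X Y Z : C} (f : ctxObj o Ξ ⟶ X) (g : ctxObj o Ξ ⟶ Y)
    (m : X ⊗ Y ⟶ Z) :
    i.bagSub o b ≫ pair f g ≫ m =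
      (b.antidiagonal.map fun p => pair (i.bagSub o p.1 ≫ f) (i.bagSub o p.2 ≫ g) ≫ m).sum := by
  have h := i.sub_comul o (bagDenote o b).antidiagonal (bagProd (bagDenote o b))
    (fun p => bagProd p.1) (fun p => bagProd p.2)
    (bagProd_comul _ (isPointed_of_mem_bagDenote hp o b))
  rw [bagDenote, antidiagonal_map, Multiset.map_map] at h
  rw [bagSub, pair, Category.assoc, ← Category.assoc, h, sum_comp]
  simp only [Function.comp_def, Prod.map, pair_tensor_assoc]
  rfl

theorem Ins.bagSub_counit (hp : PidCurry C) (o : C) {A : Ty} {Γ Ξ : List Ty} (i : Ins A Γ Ξ)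
    (b : Multiset (Exp (.tm A) i.base)) :
    i.bagSub o b ≫ ε _ = if b.card = 0 then ε _ else 0 := by
  have h := bagProd_counit _ (isPointed_of_mem_bagDenote hp o b)
  rw [bagDenote, Multiset.card_map] at h
  split_ifs at h ⊢ with hb
  · exact i.sub_counit o _ h
  · exact i.sub_counit_zero o _ h

theorem Ins.bagSub_proj_inr (hp : PidCurry C) (o : C) {A B : Ty} {Γ Ξ : List Ty} (i : Ins A Γ Ξ)
    (b : Multiset (Exp (.tm A) i.base)) (x : Var Ξ B) (y : Var Γ B) (hx : i.compare x = .inr y) :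
    i.bagSub o b ≫ x.proj o = if b.card = 0 then y.proj o else 0 := by
  have h := bagProd_counit _ (isPointed_of_mem_bagDenote hp o b)
  rw [bagDenote, Multiset.card_map] at h
  split_ifs at h ⊢ with hb
  · exact i.sub_proj_inr o x y hx _ h
  · exact i.sub_proj_inr_zero o x y hx _ h

theorem Ins.bagSub_proj_inl (hp : PidCurry C) (o : C) {A : Ty} {Γ Ξ : List Ty} (i : Ins A Γ Ξ)
    (b : Multiset (Exp (.tm A) i.base)) (x : Var Ξ A) (hx : i.compare x = .inl rfl) :
    i.bagSub o b ≫ x.proj o ≫ pid _ =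
      if b.card = 1 then sumDenote o (b.map i.weak) else 0 := by
  have h := bagProd_pid _ (isPointed_of_mem_bagDenote hp o b)
  have h' := i.sub_proj_inl o x rfl hx (bagProd (bagDenote o b))
  rw [eqToHom_refl, Category.comp_id] at h'
  rw [← Category.assoc, bagSub, h', Category.assoc, h, bagDenote, Multiset.card_map]
  split_ifs
  · rw [comp_sum, sumDenote, Multiset.map_map]
    exact congrArg Multiset.sum (Multiset.map_congr rfl fun e _ => (i.denote_weak o e).symm)
  · exact comp_zero _

/-- Invariance under substitution, for expressions with two immediate subexpressions. -/
theorem bagSub_comp_pair_denote (hp : PidCurry C) (o : C) {A : Ty} {Γ Ξ : List Ty}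
    (i : Ins A Γ Ξ) (b : Multiset (Exp (.tm A) i.base)) {k k' l : Kind} (s : Exp k Ξ)
    (c : Exp k' Ξ) (K : Exp k Γ → Exp k' Γ → Exp l Γ) (m : k.obj o ⊗ k'.obj o ⟶ l.obj o)
    (hK : ∀ s c, (K s c).denote o = pair (s.denote o) (c.denote o) ≫ m)
    (hs : ∀ b, i.bagSub o b ≫ s.denote o = sumDenote o (s.subst i (b.map i.weak)))
    (hc : ∀ b, i.bagSub o b ≫ c.denote o = sumDenote o (c.subst i (b.map i.weak))) :
    i.bagSub o b ≫ pair (s.denote o) (c.denote o) ≫ m =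
      sumDenote o ((b.map i.weak).antidiagonal.bind fun p =>
        (s.subst i p.1 ×ˢ c.subst i p.2).map fun q => K q.1 q.2) := by
  rw [i.bagSub_comp_pair hp, antidiagonal_map, sumDenote, Multiset.map_bind, Multiset.sum_bind,
    Multiset.map_map]
  congr 1
  refine Multiset.map_congr rfl fun p _ => ?_
  rw [hs, hc, sumDenote, sumDenote, sum_pair_sum_comp]
  simp only [Function.comp_def, Multiset.map_map, hK, Prod.map]

theorem bagSub_comp_denote_var (hp : PidCurry C) (o : C) {A : Ty} {Γ Ξ : List Ty}
    (i : Ins A Γ Ξ) (b : Multiset (Exp (.tm A) i.base)) {As : List Ty}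
    (y : Var Ξ (arrs As .base)) (c : Exp (.sq As) Ξ)
    (hc : ∀ b, i.bagSub o b ≫ c.denote o = sumDenote o (c.subst i (b.map i.weak))) :
    i.bagSub o b ≫ (Exp.var y c).denote o =
      sumDenote o ((Exp.var y c).subst i (b.map i.weak)) := by
  refine (i.bagSub_comp_pair hp o b _ _ _).trans ?_
  rw [Exp.subst, antidiagonal_map, sumDenote, Multiset.map_bind, Multiset.sum_bind,
    Multiset.map_map]
  congr 1
  refine Multiset.map_congr rfl fun p _ => ?_
  simp only [Function.comp_def, Prod.map]
  rw [hc]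
  rcases hy : i.compare y with h | z
  · subst h
    -- Moving `pid` before `uncurrySeq` places it right after the projection, where it tests whether
    -- the bag is a singleton.
    rw [hp.pid_uncurrySeq, ← Category.assoc (y.proj o), ← Category.assoc,
      i.bagSub_proj_inl hp o p.1 y hy, Multiset.card_map]
    dsimp only
    split_ifs
    · refine (congrArg (fun f => pair f _ ≫ ev _ _) (sum_comp _ _ _)).trans
        ((sum_pair_sum_comp _ _ _ _ _).trans ?_)
      rw [Multiset.map_map]
      exact congrArg Multiset.sum
        (Multiset.map_congr rfl fun q _ => (Exp.denote_apps o As q.1 q.2).symm)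
    · rw [zero_comp, zero_pair]
      exact zero_comp _
  · rw [← Category.assoc, i.bagSub_proj_inr hp o p.1 y z hy, Multiset.card_map]
    dsimp only
    split_ifs
    · rw [Multiset.map_map]
      exact pair_sum_comp _ _ _ _
    · rw [zero_comp, zero_pair]
      exact zero_comp _

theorem bagSub_comp_denote (hp : PidCurry C) (o : C) {A : Ty} {k : Kind} {Ξ : List Ty}
    (e : Exp k Ξ) {Γ : List Ty} (i : Ins A Γ Ξ) (b : Multiset (Exp (.tm A) i.base)) :
    i.bagSub o b ≫ e.denote o = sumDenote o (e.subst i (b.map i.weak)) := by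
  induction e generalizing Γ with
  | lam s ih =>
    refine (comp_curry _ _).trans ((congrArg curry (ih i.there b)).trans ?_)
    rw [Exp.subst, sumDenote, sumDenote, Multiset.map_map, Multiset.map_map]
    exact curry_sum _ _
  | app s c ihs ihc =>
    rw [Exp.subst]
    exact bagSub_comp_pair_denote hp o i b s c Exp.app (ev _ _) (fun _ _ => rfl) (ihs i) (ihc i)
  | var y c ih => exact bagSub_comp_denote_var hp o i b y c (ih i)
  | bnil =>
    refine (Category.assoc _ _ _).symm.trans ((congrArg (· ≫ η _) (i.bagSub_counit hp o b)).trans ?_)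
    rw [Exp.subst, Multiset.card_map]
    split_ifs
    · exact (Multiset.sum_singleton _).symm
    · exact zero_comp _
  | bcons s c ihs ihc =>
    rw [Exp.subst]
    refine Eq.trans (congrArg _ (prod_eq_pair _ _)) ?_
    exact bagSub_comp_pair_denote hp o i b s c Exp.bcons (μ _) (fun _ _ => prod_eq_pair _ _)
      (ihs i) (ihc i)
  | snil =>
    refine (i.bagSub_counit hp o b).trans ?_
    rw [Exp.subst, Multiset.card_map]
    split_ifs
    · exact (Multiset.sum_singleton _).symm
    · rfl
  | scons s c ihs ihc =>
    rw [Exp.subst]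
    -- An identity is appended to fit the pattern of a pairing followed by a fixed morphism.
    refine Eq.trans (congrArg _ (Category.comp_id _).symm) ?_
    exact bagSub_comp_pair_denote hp o i b s c Exp.scons (𝟙 _)
      (fun _ _ => (Category.comp_id _).symm) (ihs i) (ihc i)

/-! ### Invariance under reduction -/

theorem denote_beta (hp : PidCurry C) (o : C) {Γ : List Ty} {A B : Ty}
    (s : Exp (.tm B) (A :: Γ)) (b : Exp (.bg A) Γ) :
    ((s.lam).app b).denote o = sumDenote o (s.subst .here b.elems) := by
  refine (pair_curry_ev _ _).trans ?_
  rw [b.denote_bag]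
  have h := bagSub_comp_denote hp o s .here b.elems
  -- At the outermost position there is nothing to weaken by, so `Ins.weak` is the identity.
  have hw : b.elems.map (Ins.weak (A := A) (.here (Γ := Γ))) = b.elems := Multiset.map_id' _
  rw [hw] at h
  exact h

/-- One argument for all contextual rules: `K` is a one-hole context and `φ` its interpretation,
which only has to preserve the given sum. -/
theorem denote_eq_sumDenote_map (o : C) {k l : Kind} {Γ Δ : List Ty} {e : Exp k Γ}
    {E : Multiset (Exp k Γ)} (h : e.denote o = sumDenote o E) (K : Exp k Γ → Exp l Δ)
    (φ : (ctxObj o Γ ⟶ k.obj o) → (ctxObj o Δ ⟶ l.obj o))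
    (hK : ∀ e, (K e).denote o = φ (e.denote o))
    (hφ : φ (E.map fun e => e.denote o).sum = (E.map fun e => φ (e.denote o)).sum) :
    (K e).denote o = sumDenote o (E.map K) := by
  rw [hK, h, sumDenote, hφ, sumDenote, Multiset.map_map]
  simp only [Function.comp_def, hK]

theorem Exp.Step.denote_eq (hp : PidCurry C) (o : C) {k : Kind} {Γ : List Ty} {e : Exp k Γ}
    {E : Multiset (Exp k Γ)} (h : Exp.Step e E) : e.denote o = sumDenote o E := by
  induction h with
  | beta s b => exact denote_beta hp o s b
  | lam _ ih =>
    exact denote_eq_sumDenote_map o ih Exp.lam (fun f => curry f) (fun _ => rfl) (curry_sum _ _)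
  | appFun b _ ih =>
    exact denote_eq_sumDenote_map o ih (fun s => Exp.app s b)
      (fun f => pair f (b.denote o) ≫ ev _ _) (fun _ => rfl) (sum_pair_comp _ _ _ _)
  | appArg s _ ih =>
    exact denote_eq_sumDenote_map o ih (fun b => Exp.app s b)
      (fun f => pair (s.denote o) f ≫ ev _ _) (fun _ => rfl) (pair_sum_comp _ _ _ _)
  | var x _ ih =>
    exact denote_eq_sumDenote_map o ih (Exp.var x)
      (fun f => pair (x.proj o ≫ uncurrySeq o _ ≫ pid _) f ≫ ev _ _) (fun _ => rfl)
      (pair_sum_comp _ _ _ _)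
  | bagHead b _ ih =>
    exact denote_eq_sumDenote_map o ih (fun s => Exp.bcons s b)
      (fun f => pair f (b.denote o) ≫ μ _) (fun _ => prod_eq_pair _ _) (sum_pair_comp _ _ _ _)
  | bagTail s _ ih =>
    exact denote_eq_sumDenote_map o ih (fun b => Exp.bcons s b)
      (fun f => pair (s.denote o) f ≫ μ _) (fun _ => prod_eq_pair _ _) (pair_sum_comp _ _ _ _)
  | seqHead c _ ih =>
    exact denote_eq_sumDenote_map o ih (fun b => Exp.scons b c)
      (fun f => pair f (c.denote o)) (fun _ => rfl) (sum_pair _ _ _)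
  | seqTail b _ ih =>
    exact denote_eq_sumDenote_map o ih (fun c => Exp.scons b c)
      (fun f => pair (b.denote o) f) (fun _ => rfl) (pair_sum _ _ _)

theorem Tm.isPointed_interp (hp : PidCurry C) (o : C) {Γ : List Ty} {A : Ty} (s : Tm Γ A) :
    IsPointed (s.interp o) := by
  induction s using Quotient.inductionOn with
  | h e => exact (congrArg IsPointed (e.interp_tm o)).mpr (e.isPointed_denote hp o)

theorem Tm.Step.interp_eq (hp : PidCurry C) (o : C) {Γ : List Ty} {A : Ty} {s : Tm Γ A}
    {S : Multiset (Tm Γ A)} (h : s.Step S) : s.interp o = sumInterp o S := by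
  obtain ⟨e, E, hE, rfl, rfl⟩ := h
  refine (e.interp_tm o).trans ((hE.denote_eq hp o).trans ?_)
  refine Eq.trans ?_ (congrArg Multiset.sum (Multiset.map_map _ _ _)).symm
  exact congrArg Multiset.sum (Multiset.map_congr rfl fun e _ => (e.interp_tm o).symm)

theorem SumStep.sumInterp_eq (hp : PidCurry C) (o : C) {Γ : List Ty} {A : Ty}
    {S S' : Multiset (Tm Γ A)} (h : SumStep S S') : sumInterp o S = sumInterp o S' := by
  obtain ⟨s, T, U, hs, rfl, rfl⟩ := h
  have h := hs.interp_eq hp o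
  rw [sumInterp] at h
  rw [sumInterp, sumInterp, Multiset.map_add, Multiset.map_add, Multiset.sum_add,
    Multiset.sum_add, Multiset.map_singleton, Multiset.sum_singleton, h]

end Soundness
end ResourceCalculus

open ResourceCalculus
theorem mainTheorem4 {C : Type*} [Category C] [MonoidalCategory C] [SymmetricCategory C]
    [ClosedResourceCategory C]
    (hpid : ∀ (X A B : C) (f : X ⊗ A ⟶ B),
      curry f ≫ ResourceCategory.pid ((ClosedResourceCategory.exp A).obj B) =
        curry (f ≫ ResourceCategory.pid B))
    (o : C) (Γ : List Ty) (A : Ty) :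
    (∀ s : Tm Γ A, IsPointed (s.interp o)) ∧
    ∀ S S' : Multiset (Tm Γ A), SumStep S S' → sumInterp o S = sumInterp o S' :=
  ⟨fun s => s.isPointed_interp hpid o, fun _ _ h => h.sumInterp_eq hpid o⟩
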